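/- Let $\Omega\subset\mathbb R^d$, $d\in\{2,3\}$, be a bounded polyhedral domain (equal to the interior of its closure) with a conforming simplicial triangulation $\mathcal T_h$, let $\mathcal E_h$ be the set of its edges ($d=2$) or faces ($d=3$), and let $l\ge 1$. Put $\boldsymbol U(K)=BDM_l(K)$ for all $K\in\mathcal T_h$, or $\boldsymbol U(K)=BDFM_l(K)$ for all $K\in\mathcal T_h$. For $i=1,\dots,n$ let $$\boldsymbol U_h=\{\boldsymbol u\in H(\mathrm{div};\Omega): \boldsymbol u|_K\in \boldsymbol U(K)\ \forall K\in\mathcal T_h,\ \boldsymbol u\cdot\boldsymbol n=0 \text{ on }\partial\Omega\},$$ $$\boldsymbol V_{i,h}=\{\boldsymbol v\in H(\mathrm{div};\Omega): \boldsymbol v|_K\in RT_{l-1}(K)\ \forall K\in\mathcal T_h,\ \boldsymbol v\cdot\boldsymbol n=0 \text{ on }\partial\Omega\},$$ $$P_{i,h}=\{q\in L^2(\Omega): q|_K\in P_{l-1}(K)\ \forall K\in\mathcal T_h,\ \textstyle\int_\Omega q\,dx=0\},$$ and $\boldsymbol V_h=\prod_i\boldsymbol V_{i,h}$, $\boldsymbol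 P_h=\prod_i P_{i,h}$. Let $\lambda>0$, $R_i^{-1}>0$, $\alpha_{p_i}\ge0$, $\alpha_{ij}\ge0$ $(i,j=1,\dots,n)$ and $\eta\in\mathbb R$ be constants, $\boldsymbol f\in L^2(\Omega)^d$ and $g_i\in L^2(\Omega)$. Let $(\cdot,\cdot)$ be the $L^2(\Omega)$ inner product and $$a_h(\boldsymbol u,\boldsymbol w)=\sum_{K\in\mathcal T_h}\int_K\boldsymbol\epsilon(\boldsymbol u):\boldsymbol\epsilon(\boldsymbol w)\,dx-\sum_{e\in\mathcal E_h}\int_e\{\boldsymbol\epsilon(\boldsymbol u)\}\cdot[\boldsymbol w_t]\,ds-\sum_{e\in\mathcal E_h}\int_e\{\boldsymbol\epsilon(\boldsymbol w)\}\cdot[\boldsymbol u_t]\,ds+\sum_{e\in\mathcal E_h}\int_e\eta h_e^{-1}[\boldsymbol u_t]\cdot[\boldsymbol w_t]\,ds .$$ Here $\boldsymbol\epsilon$ is the symmetric gradient on each element, $h_e$ is the diameter of $e$ and $\boldsymbol u_t=\boldsymbol u-(\boldsymbol u\cdot\boldsymbol n)\boldsymbol n$ on $e$. On an interior $e=\partial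 K_1\cap\partial K_2$, with $\boldsymbol n_k$ the unit normal to $e$ exterior to $K_k$, $\{\boldsymbol\tau\}=\frac12(\boldsymbol\tau|_{K_1}\boldsymbol n_1-\boldsymbol\tau|_{K_2}\boldsymbol n_2)$ and $[\boldsymbol v]=\boldsymbol v|_{K_1}-\boldsymbol v|_{K_2}$; on a boundary $e$, $\{\boldsymbol\tau\}=\boldsymbol\tau\boldsymbol n$ and $[\boldsymbol v]=\boldsymbol v$. Let $(\boldsymbol u_h;\boldsymbol v_h;\boldsymbol p_h)\in\boldsymbol U_h\times\boldsymbol V_h\times\boldsymbol P_h$ satisfy, for all $(\boldsymbol w_h;\boldsymbol z_h;\boldsymbol q_h)\in\boldsymbol U_h\times\boldsymbol V_h\times\boldsymbol P_h$ and all $i=1,\dots,n$, $$a_h(\boldsymbol u_h,\boldsymbol w_h)+\lambda(\mathrm{div}\,\boldsymbol u_h,\mathrm{div}\,\boldsymbol w_h)-\sum_{j=1}^n(p_{j,h},\mathrm{div}\,\boldsymbol w_h)=(\boldsymbol f,\boldsymbol w_h),$$ $$(R_i^{-1}\boldsymbol v_{i,h},\boldsymbol z_{i,h})-(p_{i,h},\mathrm{div}\,\boldsymbol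 z_{i,h})=0,$$ $$-(\mathrm{div}\,\boldsymbol u_h,q_{i,h})-(\mathrm{div}\,\boldsymbol v_{i,h},q_{i,h})-(\alpha_{p_i}+\alpha_{ii})(p_{i,h},q_{i,h})+\sum_{j\ne i}\alpha_{ij}(p_{j,h},q_{i,h})=(g_i,q_{i,h}).$$ Then, with $Q_{i,h}$ the $L^2(\Omega)$-orthogonal projection onto $P_{i,h}$ (so $Q_{i,h}g_i$ is well defined and unique), for $i=1,\dots,n$, every $K\in\mathcal T_h$ and every $x\in K$, $$-\mathrm{div}\,\boldsymbol u_h-\mathrm{div}\,\boldsymbol v_{i,h}-(\alpha_{p_i}+\alpha_{ii})p_{i,h}+\sum_{j\ne i}\alpha_{ij}p_{j,h}=Q_{i,h}g_i ,$$ where all functions are taken as their polynomial restrictions to $K$. Furthermore, if $g_i=0$, then for this $i$ the left-hand side is $0$ at every $x\in K$ for every $K\in\mathcal T_h$. -/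

import Mathlib

open MeasureTheory
open scoped Classical ContDiff

noncomputable section

namespace MPET

/-- Euclidean space `ℝ^d`. -/
abbrev Pt (d : ℕ) := EuclideanSpace ℝ (Fin d)

/-- Real polynomials in `d` variables. -/
abbrev Poly (d : ℕ) := MvPolynomial (Fin d) ℝ

/-- Vector fields on `ℝ^d` with polynomial components. -/
abbrev VecPoly (d : ℕ) := Fin d → Poly d

/-! ### Weak divergence, weak gradient, `H(div)` and the normal trace -/

/-- `φ ∈ C_c^∞(Ω)`. -/
def IsTest {d : ℕ} (Ω : Set (Pt d)) (φ : Pt d → ℝ) : Prop :=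
  ContDiff ℝ ∞ φ ∧ HasCompactSupport φ ∧ tsupport φ ⊆ Ω

/-- `g` is the weak divergence of `v` in `Ω`. -/
def IsWeakDiv {d : ℕ} (Ω : Set (Pt d)) (v : Pt d → Pt d) (g : Pt d → ℝ) : Prop :=
  ∀ φ, IsTest Ω φ → ∫ x in Ω, inner ℝ (v x) (gradient φ x) = -∫ x in Ω, g x * φ x

/-- `G` is the weak gradient of the scalar function `φ` in `Ω`. -/
def IsWeakGrad {d : ℕ} (Ω : Set (Pt d)) (φ : Pt d → ℝ) (G : Pt d → Pt d) : Prop :=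
  ∀ ψ, IsTest Ω ψ → ∫ x in Ω, φ x • gradient ψ x = -∫ x in Ω, ψ x • G x

/-- `L²(Ω)` for functions with values in a normed space. -/
def InL2 {d : ℕ} {F : Type*} [NormedAddCommGroup F] (Ω : Set (Pt d)) (f : Pt d → F) : Prop :=
  MemLp f 2 (volume.restrict Ω)

/-- `v ∈ H(div; Ω)`: both `v` and its weak divergence are square integrable. -/
def InHDiv {d : ℕ} (Ω : Set (Pt d)) (v : Pt d → Pt d) : Prop :=
  InL2 Ω v ∧ ∃ g, InL2 Ω g ∧ IsWeakDiv Ω v g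

/-- `v · n = 0` on `∂Ω` for `v ∈ H(div; Ω)`. The normal trace of `v` is the functional
`φ ↦ ∫_Ω v · ∇φ + ∫_Ω (div v) φ` on `H¹(Ω)`; it is required to vanish. -/
def ZeroNormalTrace {d : ℕ} (Ω : Set (Pt d)) (v : Pt d → Pt d) : Prop :=
  ∀ g, InL2 Ω g → IsWeakDiv Ω v g →
    ∀ φ G, InL2 Ω φ → InL2 Ω G → IsWeakGrad Ω φ G →
      (∫ x in Ω, inner ℝ (v x) (G x)) + (∫ x in Ω, g x * φ x) = 0

/-! ### Triangulations -/

/-- A (conforming, simplicial) triangulation of the open set `Ω ⊆ ℝ^d`. -/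
structure Triangulation (d : ℕ) (Ω : Set (Pt d)) where
  /-- all simplices of the triangulation, of all dimensions, given by their vertex sets -/
  complex : Geometry.SimplicialComplex ℝ (Pt d)
  finite : complex.faces.Finite
  /-- every simplex is a face of a `d`-dimensional one -/
  pure : ∀ s ∈ complex.faces, ∃ t ∈ complex.faces, s ⊆ t ∧ t.card = d + 1
  /-- the simplices fill the closure of `Ω` -/
  space_eq : complex.space = closure Ω
  /-- `Ω` is the open set inside its boundary (no cracks, no punctures) -/
  interior_eq : interior (closure Ω) = Ω

namespace Triangulation

variable {d : ℕ} {Ω : Set (Pt d)} (T : Triangulation d Ω)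

/-- The elements `K ∈ 𝒯_h`: the `d`-dimensional simplices. -/
def Element : Type := {s : Finset (Pt d) // s ∈ T.complex.faces ∧ s.card = d + 1}

/-- The edges (`d = 2`) or faces (`d = 3`) `e ∈ ℰ_h`: the `(d-1)`-dimensional simplices. -/
def Face : Type := {s : Finset (Pt d) // s ∈ T.complex.faces ∧ s.card = d}

instance : Fintype T.Element :=
  (T.finite.subset (show {s | s ∈ T.complex.faces ∧ s.card = d + 1} ⊆ T.complex.faces
    from fun _ h => h.1)).fintype

instance : Fintype T.Face :=
  (T.finite.subset (show {s | s ∈ T.complex.faces ∧ s.card = d} ⊆ T.complex.faces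
    from fun _ h => h.1)).fintype

variable {T}

/-- The element as a closed subset of `ℝ^d`. -/
def Element.carrier (K : T.Element) : Set (Pt d) := convexHull ℝ (K.1 : Set (Pt d))

/-- The edge or face as a closed subset of `ℝ^d`. -/
def Face.carrier (e : T.Face) : Set (Pt d) := convexHull ℝ (e.1 : Set (Pt d))

/-- `e` is an edge or face of the element `K`. -/
def IsFaceOf (e : T.Face) (K : T.Element) : Prop := e.1 ⊆ K.1

/-- The unit normal to the face `e` of the element `K` pointing to the exterior of `K`: the vector
from the barycentre of `K` to the barycentre of `e`, projected to the orthogonal complement of the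
directions of `e` and normalized. -/
def outerNormal (K : T.Element) (e : T.Face) : Pt d :=
  let m : Pt d := (vectorSpan ℝ (e.1 : Set (Pt d)))ᗮ.starProjection
    (e.1.centroid ℝ id - K.1.centroid ℝ id)
  ‖m‖⁻¹ • m

/-! ### The two sides of a face -/

theorem Face.exists_side (e : T.Face) : ∃ K : T.Element, IsFaceOf e K := by
  obtain ⟨t, ht, hst, hc⟩ := T.pure e.1 e.2.1
  exact ⟨⟨t, ht, hc⟩, hst⟩

/-- The element `K₁` at the face `e`. The order in which the two elements at an interior face are
called `K₁` and `K₂` is immaterial. -/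
def Face.side₁ (e : T.Face) : T.Element := e.exists_side.choose

/-- `e` is an interior face: it belongs to a second element; otherwise it is a boundary face. -/
def Face.IsInterior (e : T.Face) : Prop := ∃ K : T.Element, K ≠ e.side₁ ∧ IsFaceOf e K

/-- The element `K₂` at an interior face `e`. -/
def Face.side₂ (e : T.Face) (h : e.IsInterior) : T.Element := h.choose

end Triangulation

/-! ### Polynomials and piecewise polynomial functions -/

section Polynomials

variable {d : ℕ}

/-- Value of a polynomial at a point. -/
def ev (p : Poly d) (x : Pt d) : ℝ := MvPolynomial.eval (fun i => x i) p

/-- Value of a polynomial vector field at a point. -/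
def evVec (v : VecPoly d) (x : Pt d) : Pt d := WithLp.toLp 2 fun i => ev (v i) x

/-- `P_k`: polynomials of total degree at most `k`. -/
def Pk (d k : ℕ) : Submodule ℝ (Poly d) := MvPolynomial.restrictTotalDegree (Fin d) ℝ k

/-- Divergence of a polynomial vector field. -/
def divPoly (v : VecPoly d) : Poly d := ∑ i, MvPolynomial.pderiv i (v i)

/-- The strain `ε(v) = (∇v + (∇v)ᵀ) / 2` of a polynomial vector field, at the point `x`. -/
def strain (v : VecPoly d) (x : Pt d) : Matrix (Fin d) (Fin d) ℝ :=
  fun i j => (1 / 2 : ℝ) *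
    (ev (MvPolynomial.pderiv j (v i)) x + ev (MvPolynomial.pderiv i (v j)) x)

end Polynomials

section Spaces

variable {d : ℕ} {Ω : Set (Pt d)} (T : Triangulation d Ω)

/-- A piecewise polynomial scalar function `q`, given by its restrictions `q|_K`. -/
abbrev Scal := T.Element → Poly d

/-- A piecewise polynomial vector field `v`, given by its restrictions `v|_K`. -/
abbrev Vect := T.Element → VecPoly d

variable {T}

/-- The piecewise polynomial `q` as a function. On points common to several elements (a null set)
one of the values is taken. -/
def Scal.toFun (q : Scal T) (x : Pt d) : ℝ :=
  if h : ∃ K : T.Element, x ∈ K.carrier then ev (q h.choose) x else 0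

/-- The piecewise polynomial vector field `v` as a function. -/
def Vect.toFun (v : Vect T) (x : Pt d) : Pt d :=
  if h : ∃ K : T.Element, x ∈ K.carrier then evVec (v h.choose) x else 0

/-- Divergence of a piecewise polynomial vector field, on each element. -/
def Vect.div (v : Vect T) : Scal T := fun K => divPoly (v K)

/-- The two choices for the local displacement space. -/
inductive Family
  | BDM
  | BDFM

/-- `BDM_l(K) = P_l(K)^d`, and `BDFM_l(K)`, the fields in `P_l(K)^d` whose normal component on each
edge or face of `K` is a polynomial of degree at most `l - 1`. -/
def localU : Family → ℕ → T.Element → Set (VecPoly d)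
  | .BDM, l, _ => {v | ∀ i, v i ∈ Pk d l}
  | .BDFM, l, K => {v | (∀ i, v i ∈ Pk d l) ∧
      ∀ e : T.Face, Triangulation.IsFaceOf e K → ∃ r ∈ Pk d (l - 1), ∀ x ∈ e.carrier,
        inner ℝ (evVec v x) (Triangulation.outerNormal K e) = ev r x}

/-- `RT_k(K) = P_k(K)^d + x P_k(K)`. -/
def localRT (d k : ℕ) : Set (VecPoly d) :=
  {v | ∃ a : VecPoly d, ∃ b : Poly d, (∀ i, a i ∈ Pk d k) ∧ b ∈ Pk d k ∧
    ∀ i, v i = a i + MvPolynomial.X i * b}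

variable (T)

/-- The displacement space `U_h`. -/
def Uh (fam : Family) (l : ℕ) : Set (Vect T) :=
  {u | (∀ K, u K ∈ localU fam l K) ∧ InHDiv Ω u.toFun ∧ ZeroNormalTrace Ω u.toFun}

/-- The flux space `V_{i,h}`, the same for every `i`. -/
def Vh (l : ℕ) : Set (Vect T) :=
  {v | (∀ K, v K ∈ localRT d (l - 1)) ∧ InHDiv Ω v.toFun ∧ ZeroNormalTrace Ω v.toFun}

/-- The pressure space `P_{i,h}`, the same for every `i`. -/
def Ph (l : ℕ) : Set (Scal T) :=
  {q | (∀ K, q K ∈ Pk d (l - 1)) ∧ InL2 Ω q.toFun ∧ ∫ x in Ω, q.toFun x = 0}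

variable {T}

/-- `q` is the `L²(Ω)`-orthogonal projection of `g` on `P_{i,h}`. -/
def IsL2Projection (l : ℕ) (g : Pt d → ℝ) (q : Scal T) : Prop :=
  q ∈ Ph T l ∧ ∀ r ∈ Ph T l, ∫ x in Ω, (g x - q.toFun x) * r.toFun x = 0

/-! ### The bilinear form of the elasticity part -/

/-- The average `{ε(u)}` on the face `e`. -/
def avgStrain (u : Vect T) (e : T.Face) (x : Pt d) : Pt d :=
  let τn (K : T.Element) : Pt d :=
    WithLp.toLp 2 ((strain (u K) x).mulVec (fun i => Triangulation.outerNormal K e i))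
  if h : e.IsInterior then (1 / 2 : ℝ) • (τn e.side₁ - τn (e.side₂ h)) else τn e.side₁

/-- The tangential component `w - (w · n) n` on the face `e`. -/
def tangential (e : T.Face) (w : Pt d) : Pt d :=
  w - inner ℝ w (Triangulation.outerNormal e.side₁ e) • Triangulation.outerNormal e.side₁ e

/-- The jump `[u_t]` of the tangential component on the face `e`. -/
def jumpTan (u : Vect T) (e : T.Face) (x : Pt d) : Pt d :=
  if h : e.IsInterior then
    tangential e (evVec (u e.side₁) x) - tangential e (evVec (u (e.side₂ h)) x)
  else tangential e (evVec (u e.side₁) x)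

/-- `h_e`: the diameter of the face `e`. -/
def faceSize (e : T.Face) : ℝ := Metric.diam e.carrier

/-- `∫_e φ ds`, with respect to the `(d-1)`-dimensional surface measure. -/
def faceIntegral (e : T.Face) (φ : Pt d → ℝ) : ℝ := ∫ x in e.carrier, φ x ∂μHE[d - 1]

/-- The bilinear form `a_h`, with stabilization parameter `η`. -/
def aForm (η : ℝ) (u w : Vect T) : ℝ :=
  ∑ K : T.Element, (∫ x in K.carrier, ∑ i, ∑ j, strain (u K) x i j * strain (w K) x i j)
    - ∑ e : T.Face, faceIntegral e (fun x => inner ℝ (avgStrain u e x) (jumpTan w e x))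
    - ∑ e : T.Face, faceIntegral e (fun x => inner ℝ (avgStrain w e x) (jumpTan u e x))
    + ∑ e : T.Face,
        faceIntegral e (fun x => η * (faceSize e)⁻¹ * inner ℝ (jumpTan u e x) (jumpTan w e x))

end Spaces

/-! ### The discrete problem -/

/-- The (rescaled) parameters of the model with `n` networks. Only the off-diagonal entries of `α`
couple different networks; `α i i` enters through the sum `αp i + α i i`. -/
structure Params (n : ℕ) where
  lam : ℝ
  Rinv : Fin n → ℝ
  αp : Fin n → ℝ
  α : Fin n → Fin n → ℝ
  lam_pos : 0 < lam
  Rinv_pos : ∀ i, 0 < Rinv i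
  αp_nonneg : ∀ i, 0 ≤ αp i
  α_nonneg : ∀ i j, 0 ≤ α i j

variable {d : ℕ} {Ω : Set (Pt d)} {T : Triangulation d Ω} {n : ℕ}

/-- `(u_h; v_h; p_h) ∈ U_h × V_h × P_h` solves the discrete problem with data `f` and `g`. -/
structure IsDiscreteSolution (fam : Family) (l : ℕ) (η : ℝ) (c : Params n)
    (f : Pt d → Pt d) (g : Fin n → Pt d → ℝ)
    (u : Vect T) (v : Fin n → Vect T) (p : Fin n → Scal T) : Prop where
  u_mem : u ∈ Uh T fam l
  v_mem : ∀ i, v i ∈ Vh T l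
  p_mem : ∀ i, p i ∈ Ph T l
  momentum : ∀ w ∈ Uh T fam l,
    aForm η u w + c.lam * (∫ x in Ω, u.div.toFun x * w.div.toFun x)
      - ∑ i, (∫ x in Ω, (p i).toFun x * w.div.toFun x) = ∫ x in Ω, inner ℝ (f x) (w.toFun x)
  darcy : ∀ i, ∀ z ∈ Vh T l,
    (∫ x in Ω, inner ℝ (c.Rinv i • (v i).toFun x) (z.toFun x))
      - (∫ x in Ω, (p i).toFun x * z.div.toFun x) = 0
  mass : ∀ i, ∀ q ∈ Ph T l,
    -(∫ x in Ω, u.div.toFun x * q.toFun x) - (∫ x in Ω, (v i).div.toFun x * q.toFun x)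
      + (-c.αp i - c.α i i) * (∫ x in Ω, (p i).toFun x * q.toFun x)
      + ∑ j ∈ Finset.univ.erase i, c.α i j * (∫ x in Ω, (p j).toFun x * q.toFun x)
      = ∫ x in Ω, g i x * q.toFun x

/-- The left-hand side of the `i`-th mass-balance equation, at the point `x` of the element `K`. -/
def massBalance (c : Params n) (u : Vect T) (v : Fin n → Vect T) (p : Fin n → Scal T)
    (i : Fin n) (K : T.Element) (x : Pt d) : ℝ :=
  -ev (divPoly (u K)) x - ev (divPoly (v i K)) x - (c.αp i + c.α i i) * ev (p i K) x
    + ∑ j ∈ Finset.univ.erase i, c.α i j * ev (p j K) x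

end MPET

end

open MeasureTheory MvPolynomial
open scoped Classical ContDiff

namespace MPET

variable {d : ℕ} {Ω : Set (Pt d)} {T : Triangulation d Ω}

/-! ### Polynomials -/

/-! The left-hand side already lies in the pressure space, so the discrete mass equation, tested on
that whole space, says exactly that it is the projection of `g i`. This also gives existence of the
projection; uniqueness holds because the difference of two projections is orthogonal to itself
(`IsL2Projection.unique`).

The substance is that `div` maps both vector spaces into `Ph`. The degree bound is algebraic
(`divPoly_mem_Pk`, `divPoly_mem_Pk_of_localRT`). Square integrability holds because the weak
divergence agrees a.e. with the elementwise one (`IsWeakDiv.ae_eq_div`). The zero mean comes from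
pairing the vanishing normal trace with the constant 1 (`integral_div_eq_zero`).

Equality holds at every point, not just a.e., since a polynomial vanishing a.e. on the nonempty
interior of an element is zero (`Scal.eq_zero_of_toFun_ae`). -/

theorem pderiv_mem_Pk {k : ℕ} {p : Poly d} (hp : p ∈ Pk d (k + 1)) (i : Fin d) :
    pderiv i p ∈ Pk d k := by
  rw [Pk, mem_restrictTotalDegree] at *
  refine Finset.sup_le fun m hm => ?_
  have h : m + Finsupp.single i 1 ∈ p.support := by
    rw [mem_support_iff] at hm ⊢
    intro h0
    apply hm
    rw [coeff_pderiv, h0, zero_mul]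
  have h2 := (le_totalDegree h).trans hp
  rw [Finsupp.sum_add_index' (fun _ => rfl) (fun _ _ _ => rfl), Finsupp.sum_single_index rfl] at h2
  omega

theorem pderiv_mem_Pk_self {k : ℕ} {p : Poly d} (hp : p ∈ Pk d k) (i : Fin d) :
    pderiv i p ∈ Pk d k := by
  refine pderiv_mem_Pk (k := k) ?_ i
  rw [Pk, mem_restrictTotalDegree] at *
  omega

theorem X_mul_pderiv_mem_Pk {k : ℕ} {p : Poly d} (hp : p ∈ Pk d k) (i : Fin d) :
    X i * pderiv i p ∈ Pk d k := by
  cases k with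
  -- Multiplying by `X i` restores the degree lost by differentiating. A constant has no degree to
  -- lose, but its derivative is zero.
  | zero =>
    have h : p.totalDegree = 0 := by
      rw [Pk, mem_restrictTotalDegree] at hp
      omega
    rw [totalDegree_eq_zero_iff_eq_C.1 h, pderiv_C, mul_zero]
    exact zero_mem _
  | succ k =>
    have h := pderiv_mem_Pk hp i
    rw [Pk, mem_restrictTotalDegree] at *
    refine (totalDegree_mul _ _).trans ?_
    rw [totalDegree_X]
    omega

theorem divPoly_mem_Pk {k : ℕ} {v : VecPoly d} (hv : ∀ i, v i ∈ Pk d (k + 1)) :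
    divPoly v ∈ Pk d k :=
  Submodule.sum_mem _ fun i _ => pderiv_mem_Pk (hv i) i

/-- The part `x b` has degree up to `k + 1`, yet `∂ᵢ(xᵢ b) = b + xᵢ ∂ᵢ b` stays in `Pk d k`. -/
theorem divPoly_mem_Pk_of_localRT {k : ℕ} {v : VecPoly d} (hv : v ∈ localRT d k) :
    divPoly v ∈ Pk d k := by
  obtain ⟨a, b, ha, hb, hab⟩ := hv
  refine Submodule.sum_mem _ fun i _ => ?_
  rw [hab i, map_add, pderiv_mul, pderiv_X_self, one_mul]
  exact add_mem (pderiv_mem_Pk_self (ha i) i) (add_mem hb (X_mul_pderiv_mem_Pk hb i))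

/-- Bridge from the formal derivative `pderiv` to the analytic one, needed for integration by parts.
-/
theorem hasFDerivAt_ev (p : Poly d) (x : Pt d) :
    HasFDerivAt (ev p) (∑ i, ev (pderiv i p) x • (EuclideanSpace.proj i : Pt d →L[ℝ] ℝ)) x := by
  induction p using MvPolynomial.induction_on with
  | C a =>
    have : (ev (C a) : Pt d → ℝ) = fun _ => a := by ext y; simp [ev]
    rw [this]
    simpa [ev] using hasFDerivAt_const a x
  | add p q hp hq =>
    have : (ev (p + q) : Pt d → ℝ) = fun y => ev p y + ev q y := by ext y; simp [ev]
    rw [this]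
    refine (hp.add hq).congr_fderiv ?_
    ext w
    simp [ev, add_mul, Finset.sum_add_distrib]
  | mul_X p j hp =>
    have : (ev (p * X j) : Pt d → ℝ) = fun y => ev p y * y j := by ext y; simp [ev]
    rw [this]
    refine (hp.mul (EuclideanSpace.proj j : Pt d →L[ℝ] ℝ).hasFDerivAt).congr_fderiv ?_
    ext w
    have h1 (i : Fin d) : ev (pderiv i (p * X j)) x * w i
        = x j * (ev (pderiv i p) x * w i) + if i = j then ev p x * w i else 0 := by
      rw [pderiv_mul]
      by_cases hij : i = j
      · subst hij
        simp [ev]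
        ring
      · simp [ev, hij, pderiv_X_of_ne (Ne.symm hij)]
        ring
    have h2 : ∑ i, ev (pderiv i (p * X j)) x * w i
        = ev p x * w j + ∑ i, x j * (ev (pderiv i p) x * w i) := by
      simp only [h1, Finset.sum_add_distrib]
      simp [add_comm]
    simpa [Finset.mul_sum, -Derivation.leibniz] using h2.symm

theorem differentiable_ev (p : Poly d) : Differentiable ℝ (ev p) :=
  fun x => (hasFDerivAt_ev p x).differentiableAt

theorem continuous_ev (p : Poly d) : Continuous (ev p) := (differentiable_ev p).continuous

theorem fderiv_ev_single (p : Poly d) (x : Pt d) (i : Fin d) :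
    fderiv ℝ (ev p) x (EuclideanSpace.single i 1) = ev (pderiv i p) x := by
  rw [(hasFDerivAt_ev p x).fderiv]
  simp

theorem eq_of_ev_eq_on_open {U : Set (Pt d)} (hU : IsOpen U) (hne : U.Nonempty) {p q : Poly d}
    (h : ∀ x ∈ U, ev p x = ev q x) : p = q := by
  obtain ⟨x, hx⟩ := hne
  have hV : IsOpen ((fun y : Fin d → ℝ => (WithLp.toLp 2 y : Pt d)) ⁻¹' U) :=
    hU.preimage (PiLp.continuous_toLp 2 _)
  obtain ⟨ε, hε, hb⟩ := Metric.isOpen_iff.1 hV (fun i => x i) hx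
  -- A sup-norm ball inside the open set is a product of intervals, and a polynomial is determined
  -- by its values on a product of infinite sets.
  refine funext_set (fun i => Metric.ball (x i) ε) (fun i => ?_) fun y hy => ?_
  · rw [Real.ball_eq_Ioo]
    exact Set.Ioo_infinite (by linarith)
  · refine h _ (hb ?_)
    rw [← ball_pi _ hε] at *
    exact hy

/-! ### Integration by parts -/

theorem gradient_apply {φ : Pt d → ℝ} {x : Pt d} (i : Fin d) :
    gradient φ x i = fderiv ℝ φ x (EuclideanSpace.single i 1) := by
  rw [← inner_gradient_left, EuclideanSpace.inner_single_right]
  simp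

theorem integral_inner_evVec_gradient (v : VecPoly d) {φ : Pt d → ℝ} (hφ : ContDiff ℝ ∞ φ)
    (hc : HasCompactSupport φ) :
    ∫ x, inner ℝ (evVec v x) (gradient φ x) = -∫ x, ev (divPoly v) x * φ x := by
  have hd : Continuous (fderiv ℝ φ) := hφ.continuous_fderiv (by simp)
  have hi (i : Fin d) : Integrable fun x => ev (v i) x * fderiv ℝ φ x (EuclideanSpace.single i 1) :=
    ((continuous_ev _).mul (hd.clm_apply continuous_const)).integrable_of_hasCompactSupport
      ((hc.fderiv_apply ℝ _).mul_left)
  have hj (p : Poly d) : Integrable fun x => ev p x * φ x :=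
    ((continuous_ev _).mul hφ.continuous).integrable_of_hasCompactSupport hc.mul_left
  have h1 (x : Pt d) : inner ℝ (evVec v x) (gradient φ x)
      = ∑ i, ev (v i) x * fderiv ℝ φ x (EuclideanSpace.single i 1) := by
    simp only [PiLp.inner_apply, gradient_apply]
    simp [evVec, mul_comm]
  have h2 (x : Pt d) : ev (divPoly v) x * φ x = ∑ i, ev (pderiv i (v i)) x * φ x := by
    simp [ev, divPoly, Finset.sum_mul]
  simp_rw [h1, h2]
  rw [integral_finsetSum _ fun i _ => hi i, integral_finsetSum _ fun i _ => hj _,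
    ← Finset.sum_neg_distrib]
  refine Finset.sum_congr rfl fun i _ => ?_
  rw [integral_mul_fderiv_eq_neg_fderiv_mul_of_integrable _ (hi i) (hj _)
    (fun x _ => differentiable_ev _ x) (fun x _ => (hφ.differentiable (by simp)) x)]
  · simp_rw [fderiv_ev_single]
  · simp_rw [fderiv_ev_single]
    exact hj _

/-- The claim amounts to `∫ ∇ψ = 0`. Pairing with a vector `w` reduces it to integration by parts
against the constant field `w`, whose divergence is zero. -/
theorem isWeakGrad_one (Ω : Set (Pt d)) : IsWeakGrad Ω (fun _ => 1) 0 := by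
  rintro ψ ⟨hψ, hc, hs⟩
  have hd : Continuous (fderiv ℝ ψ) := hψ.continuous_fderiv (by simp)
  have hg : Continuous (gradient ψ) := (InnerProductSpace.toDual ℝ (Pt d)).symm.continuous.comp hd
  have hgc : HasCompactSupport (gradient ψ) :=
    (hc.fderiv (𝕜 := ℝ)).comp_left (g := (InnerProductSpace.toDual ℝ (Pt d)).symm) (by simp)
  have hgs : ∀ x, x ∉ Ω → gradient ψ x = 0 := fun x hx => by
    have : fderiv ℝ ψ x = 0 := by
      by_contra h
      exact hx (hs (support_fderiv_subset ℝ h))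
    simp [gradient, this]
  simp only [one_smul, Pi.zero_apply, smul_zero, integral_zero, neg_zero]
  rw [setIntegral_eq_integral_of_forall_compl_eq_zero hgs]
  refine ext_inner_left ℝ fun w => ?_
  rw [← integral_inner (hg.integrable_of_hasCompactSupport hgc), inner_zero_right]
  have := integral_inner_evVec_gradient (fun i => C (w i)) hψ hc
  have hw (x : Pt d) : evVec (fun i => C (w i)) x = w := by
    ext i
    simp [evVec, ev]
  simpa [hw, divPoly, ev] using this

/-! ### Geometry of the triangulation -/

open Triangulation

theorem isCompact_carrier (K : T.Element) : IsCompact K.carrier :=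
  K.1.finite_toSet.isCompact_convexHull ℝ

theorem closure_eq_iUnion_carrier (T : Triangulation d Ω) :
    closure Ω = ⋃ K : T.Element, K.carrier := by
  rw [← T.space_eq]
  ext x
  rw [Geometry.SimplicialComplex.mem_space_iff, Set.mem_iUnion]
  constructor
  · rintro ⟨s, hs, hx⟩
    obtain ⟨t, ht, hst, hc⟩ := T.pure s hs
    exact ⟨⟨t, ht, hc⟩, convexHull_mono (Finset.coe_subset.2 hst) hx⟩
  · rintro ⟨K, hx⟩
    exact ⟨K.1, K.2.1, hx⟩

theorem volume_lt_top (T : Triangulation d Ω) : volume Ω < ⊤ := by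
  refine (measure_mono subset_closure).trans_lt ?_
  rw [closure_eq_iUnion_carrier T]
  exact (isCompact_iUnion isCompact_carrier).measure_lt_top

/-- Elements only lie in `closure Ω`; `T.interior_eq` brings their interiors into `Ω` itself. -/
theorem interior_carrier_subset (K : T.Element) : interior K.carrier ⊆ Ω := by
  refine (interior_mono ?_).trans_eq T.interior_eq
  rw [closure_eq_iUnion_carrier T]
  exact Set.subset_iUnion _ K

theorem interior_carrier_nonempty (K : T.Element) : (interior K.carrier).Nonempty := by
  refine interior_convexHull_nonempty_iff_affineSpan_eq_top.2 ?_
  have h := (T.complex.indep K.2.1).affineSpan_eq_top_iff_card_eq_finrank_add_one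
  rw [Subtype.range_coe] at h
  refine h.2 ?_
  simpa using K.2.2

/-- Distinct elements meet inside the hull of their common vertices, which spans a proper affine
subspace, a null set. -/
theorem ae_unique_element (T : Triangulation d Ω) :
    ∀ᵐ x : Pt d, ∀ K K' : T.Element, x ∈ K.carrier → x ∈ K'.carrier → K = K' := by
  refine ae_all_iff.2 fun K => ae_all_iff.2 fun K' => ?_
  by_cases hKK : K = K'
  · exact .of_forall fun _ _ _ => hKK
  have hy : ∃ y ∈ K.1, y ∉ K'.1 := by
    by_contra! h
    exact hKK (Subtype.ext (Finset.eq_of_subset_of_card_le h (K'.2.2.trans K.2.2.symm).le))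
  obtain ⟨y, hy, hy'⟩ := hy
  -- Otherwise `y` would lie in the affine span of the other vertices of `K`, against affine
  -- independence.
  have hA : affineSpan ℝ (K.1 ∩ K'.1 : Set (Pt d)) ≠ ⊤ := by
    intro htop
    have h := (T.complex.indep K.2.1).notMem_affineSpan_sdiff ⟨y, hy⟩ Set.univ
    refine h (affineSpan_mono ℝ ?_ (htop ▸ AffineSubspace.mem_top ℝ _ y))
    rintro z ⟨hz, hz'⟩
    refine ⟨⟨z, hz⟩, ⟨Set.mem_univ _, fun hzy => hy' ?_⟩, rfl⟩
    cases hzy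
    exact hz'
  have h0 := Measure.addHaar_affineSubspace volume _ hA
  filter_upwards [measure_eq_zero_iff_ae_notMem.1 h0] with x hx h1 h2
  exact (hx (convexHull_subset_affineSpan _
    (T.complex.inter_subset_convexHull K.2.1 K'.2.1 ⟨h1, h2⟩))).elim

theorem ae_mem_interior (T : Triangulation d Ω) :
    ∀ᵐ x ∂volume.restrict Ω, ∃ K : T.Element, x ∈ interior K.carrier := by
  have h : ∀ᵐ x : Pt d, ∀ K : T.Element, x ∉ frontier K.carrier :=
    ae_all_iff.2 fun K => measure_eq_zero_iff_ae_notMem.1 ((convex_convexHull ℝ _).addHaar_frontier _)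
  have hΩ : MeasurableSet Ω := T.interior_eq ▸ measurableSet_interior
  filter_upwards [ae_restrict_of_ae h, ae_restrict_mem hΩ] with x hx hxΩ
  have := subset_closure hxΩ
  rw [closure_eq_iUnion_carrier T, Set.mem_iUnion] at this
  obtain ⟨K, hK⟩ := this
  exact ⟨K, by_contra fun hn => hx K ⟨subset_closure hK, hn⟩⟩

/-! ### Piecewise polynomials as functions -/

theorem Scal.toFun_ae (q : Scal T) :
    ∀ᵐ x : Pt d, ∀ K : T.Element, x ∈ K.carrier → q.toFun x = ev (q K) x := by
  filter_upwards [ae_unique_element T] with x hx K hK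
  have h : ∃ K : T.Element, x ∈ K.carrier := ⟨K, hK⟩
  rw [Scal.toFun, dif_pos h, hx _ K h.choose_spec hK]

theorem Vect.toFun_ae (v : Vect T) :
    ∀ᵐ x : Pt d, ∀ K : T.Element, x ∈ K.carrier → v.toFun x = evVec (v K) x := by
  filter_upwards [ae_unique_element T] with x hx K hK
  have h : ∃ K : T.Element, x ∈ K.carrier := ⟨K, hK⟩
  rw [Vect.toFun, dif_pos h, hx _ K h.choose_spec hK]

theorem Scal.toFun_add (q r : Scal T) (x : Pt d) : (q + r).toFun x = q.toFun x + r.toFun x := by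
  unfold Scal.toFun
  split_ifs <;> simp [ev]

theorem Scal.toFun_neg (q : Scal T) (x : Pt d) : (-q).toFun x = -q.toFun x := by
  unfold Scal.toFun
  split_ifs <;> simp [ev]

theorem Scal.toFun_sub (q r : Scal T) (x : Pt d) : (q - r).toFun x = q.toFun x - r.toFun x := by
  rw [sub_eq_add_neg, Scal.toFun_add, Scal.toFun_neg, sub_eq_add_neg]

theorem Scal.toFun_smul (a : ℝ) (q : Scal T) (x : Pt d) : (a • q).toFun x = a * q.toFun x := by
  unfold Scal.toFun
  split_ifs <;> simp [ev]

theorem Scal.toFun_sum {ι : Type*} (s : Finset ι) (q : ι → Scal T) (x : Pt d) :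
    (∑ j ∈ s, q j).toFun x = ∑ j ∈ s, (q j).toFun x := by
  unfold Scal.toFun
  split_ifs <;> simp [ev]

theorem Scal.eq_zero_of_toFun_ae {q : Scal T} (h : q.toFun =ᵐ[volume.restrict Ω] 0) : q = 0 := by
  funext K
  refine eq_of_ev_eq_on_open isOpen_interior (interior_carrier_nonempty K) fun x hx => ?_
  have h1 : ev (q K) =ᵐ[volume.restrict (interior K.carrier)] fun _ => 0 := by
    filter_upwards [ae_restrict_of_ae_restrict_of_subset (interior_carrier_subset K) h,
      ae_restrict_of_ae q.toFun_ae, ae_restrict_mem measurableSet_interior] with x h1 h2 h3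
    rw [← h2 K (interior_subset h3), h1, Pi.zero_apply]
  have h2 := Measure.eqOn_open_of_ae_eq h1 isOpen_interior (continuous_ev _).continuousOn
    continuousOn_const
  simpa [ev] using h2 hx

/-! ### The weak divergence of piecewise polynomial fields -/

/-- A test function supported in the interior of `K` sees only the polynomial `v K`, so classical
integration by parts and the fundamental lemma of the calculus of variations identify `g` there.
These interiors cover almost all of `Ω`. -/
theorem IsWeakDiv.ae_eq_div {v : Vect T} {g : Pt d → ℝ} (hg : InL2 Ω g)
    (h : IsWeakDiv Ω v.toFun g) : g =ᵐ[volume.restrict Ω] v.div.toFun := by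
  have : IsFiniteMeasure (volume.restrict Ω) := ⟨by simpa using volume_lt_top T⟩
  have key (K : T.Element) : ∀ᵐ x : Pt d, x ∈ interior K.carrier →
      g x - ev (divPoly (v K)) x = 0 := by
    refine isOpen_interior.ae_eq_zero_of_integral_contDiff_smul_eq_zero ?_ fun φ hφ hc hs => ?_
    · refine LocallyIntegrableOn.sub ?_
        ((continuous_ev _).locallyIntegrable.locallyIntegrableOn _)
      have hgi : IntegrableOn g Ω := hg.integrable (by norm_num)
      exact (hgi.mono_set (interior_carrier_subset K)).locallyIntegrableOn
    · have hsub := hs.trans (interior_carrier_subset K)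
      have h1 := h φ ⟨hφ, hc, hsub⟩
      have hφ0 : ∀ x, x ∉ tsupport φ → φ x = 0 := fun x hx => image_eq_zero_of_notMem_tsupport hx
      have hg0 : ∀ x, x ∉ tsupport φ → gradient φ x = 0 := fun x hx => by
        have : fderiv ℝ φ x = 0 := by
          by_contra h
          exact hx (support_fderiv_subset ℝ h)
        simp [gradient, this]
      rw [setIntegral_eq_integral_of_forall_compl_eq_zero
          (fun x hx => by rw [hg0 x fun hx' => hx (hsub hx'), inner_zero_right]),
        setIntegral_eq_integral_of_forall_compl_eq_zero
          (fun x hx => by rw [hφ0 x fun hx' => hx (hsub hx'), mul_zero])] at h1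
      have h2 := integral_inner_evVec_gradient (v K) hφ hc
      have h3 : ∫ x, inner ℝ (v.toFun x) (gradient φ x)
          = ∫ x, inner ℝ (evVec (v K) x) (gradient φ x) := by
        refine integral_congr_ae ?_
        filter_upwards [v.toFun_ae] with x hx
        by_cases hxs : x ∈ tsupport φ
        · rw [hx K (interior_subset (hs hxs))]
        · rw [hg0 x hxs, inner_zero_right, inner_zero_right]
      have hI1 : Integrable fun x => g x * φ x := by
        have hgi : IntegrableOn g Ω := hg.integrable (by norm_num)
        have : IntegrableOn (fun x => φ x * g x) Ω := by
          obtain ⟨C, hC⟩ := hφ.continuous.bounded_above_of_compact_support hc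
          exact hgi.bdd_mul hφ.continuous.aestronglyMeasurable (.of_forall hC)
        simp_rw [mul_comm (g _)]
        refine (integrableOn_iff_integrable_of_support_subset fun x hx => ?_).1 this
        refine hsub (by_contra fun hn => hx ?_)
        simp [hφ0 x hn]
      have hI2 : Integrable fun x => ev (divPoly (v K)) x * φ x :=
        ((continuous_ev _).mul hφ.continuous).integrable_of_hasCompactSupport hc.mul_left
      calc ∫ x, φ x • (g x - ev (divPoly (v K)) x)
          = ∫ x, (g x * φ x - ev (divPoly (v K)) x * φ x) := by
            congr 1
            ext x
            rw [smul_eq_mul]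
            ring
        _ = 0 := by
            rw [integral_sub hI1 hI2]
            linarith
  filter_upwards [ae_mem_interior T, ae_restrict_of_ae (ae_all_iff.2 key),
    ae_restrict_of_ae v.div.toFun_ae] with x ⟨K, hK⟩ h1 h2
  rw [h2 K (interior_subset hK)]
  exact sub_eq_zero.1 (h1 K hK)

theorem InHDiv.inL2_div {v : Vect T} (h : InHDiv Ω v.toFun) : InL2 Ω v.div.toFun := by
  obtain ⟨g, hg, hw⟩ := h.2
  exact (memLp_congr_ae (hw.ae_eq_div hg)).1 hg

theorem integral_div_eq_zero {v : Vect T} (h : InHDiv Ω v.toFun) (h0 : ZeroNormalTrace Ω v.toFun) :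
    ∫ x in Ω, v.div.toFun x = 0 := by
  have : IsFiniteMeasure (volume.restrict Ω) := ⟨by simpa using volume_lt_top T⟩
  obtain ⟨g, hg, hw⟩ := h.2
  -- The constant 1 is an admissible `H¹` function because `Ω` has finite measure.
  have := h0 g hg hw (fun _ => 1) 0 (memLp_const 1) MemLp.zero' (isWeakGrad_one Ω)
  rw [← integral_congr_ae (hw.ae_eq_div hg)]
  simpa using this

/-! ### The pressure space and its projection -/

theorem Ph.integrable {l : ℕ} {q : Scal T} (h : q ∈ Ph T l) :
    Integrable q.toFun (volume.restrict Ω) := by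
  have : IsFiniteMeasure (volume.restrict Ω) := ⟨by simpa using volume_lt_top T⟩
  exact MemLp.integrable (by norm_num) h.2.1

/-- `P_h` as a linear space. -/
def PhSubmodule (T : Triangulation d Ω) (l : ℕ) : Submodule ℝ (Scal T) where
  carrier := Ph T l
  zero_mem' := by
    have h : (0 : Scal T).toFun = fun _ => 0 := by
      ext x
      simpa using Scal.toFun_smul 0 (0 : Scal T) x
    exact ⟨fun K => zero_mem _, by rw [h]; exact MemLp.zero', by simp [h]⟩
  add_mem' {q r} hq hr := by
    have h : (q + r).toFun = q.toFun + r.toFun := funext (Scal.toFun_add q r)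
    refine ⟨fun K => add_mem (hq.1 K) (hr.1 K), by rw [h]; exact hq.2.1.add hr.2.1, ?_⟩
    rw [h, integral_add' (Ph.integrable hq) (Ph.integrable hr), hq.2.2, hr.2.2, add_zero]
  smul_mem' a q hq := by
    have h : (a • q).toFun = a • q.toFun := funext (Scal.toFun_smul a q)
    refine ⟨fun K => Submodule.smul_mem _ a (hq.1 K), by rw [h]; exact hq.2.1.const_smul a, ?_⟩
    simp_rw [Scal.toFun_smul, integral_const_mul, hq.2.2, mul_zero]

theorem div_mem_Ph_of_mem_Uh {fam : Family} {l : ℕ} (hl : 1 ≤ l) {u : Vect T}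
    (hu : u ∈ Uh T fam l) : u.div ∈ Ph T l := by
  refine ⟨fun K => ?_, hu.2.1.inL2_div, integral_div_eq_zero hu.2.1 hu.2.2⟩
  -- With `1 ≤ l` the truncated `l - 1` is a true predecessor, so differentiation lowers degree `l`
  -- to `l - 1`.
  obtain ⟨k, rfl⟩ : ∃ k, l = k + 1 := ⟨l - 1, by omega⟩
  refine divPoly_mem_Pk ?_
  have := hu.1 K
  cases fam
  · exact this
  · exact this.1

theorem div_mem_Ph_of_mem_Vh {l : ℕ} {v : Vect T} (hv : v ∈ Vh T l) : v.div ∈ Ph T l :=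
  ⟨fun K => divPoly_mem_Pk_of_localRT (hv.1 K), hv.2.1.inL2_div,
    integral_div_eq_zero hv.2.1 hv.2.2⟩

theorem InL2.integrable_mul {f g : Pt d → ℝ} (hf : InL2 Ω f) (hg : InL2 Ω g) :
    Integrable (fun x => f x * g x) (volume.restrict Ω) :=
  MemLp.integrable_mul hf hg

theorem isL2Projection_iff {l : ℕ} {g : Pt d → ℝ} (hg : InL2 Ω g) {q : Scal T} (hq : q ∈ Ph T l) :
    IsL2Projection l g q ↔
      ∀ r ∈ Ph T l, ∫ x in Ω, q.toFun x * r.toFun x = ∫ x in Ω, g x * r.toFun x := by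
  refine (and_iff_right hq).trans (forall₂_congr fun r hr => ?_)
  simp_rw [sub_mul]
  rw [integral_sub (InL2.integrable_mul hg hr.2.1) (InL2.integrable_mul hq.2.1 hr.2.1),
    sub_eq_zero, eq_comm]

theorem Ph.eq_zero_of_integral_sq {l : ℕ} {q : Scal T} (hq : q ∈ Ph T l)
    (h : ∫ x in Ω, q.toFun x * q.toFun x = 0) : q = 0 := by
  refine Scal.eq_zero_of_toFun_ae ?_
  have h1 := (integral_eq_zero_iff_of_nonneg (fun x => mul_self_nonneg (q.toFun x))
    (InL2.integrable_mul hq.2.1 hq.2.1)).1 h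
  filter_upwards [h1] with x hx
  exact mul_self_eq_zero.1 hx

theorem IsL2Projection.unique {l : ℕ} {g : Pt d → ℝ} (hg : InL2 Ω g) {q r : Scal T}
    (hq : IsL2Projection l g q) (hr : IsL2Projection l g r) : q = r := by
  have hs : q - r ∈ Ph T l := (PhSubmodule T l).sub_mem hq.1 hr.1
  refine sub_eq_zero.1 (Ph.eq_zero_of_integral_sq hs ?_)
  have h1 := (isL2Projection_iff hg hq.1).1 hq _ hs
  have h2 := (isL2Projection_iff hg hr.1).1 hr _ hs
  calc ∫ x in Ω, (q - r).toFun x * (q - r).toFun x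
      = ∫ x in Ω, (q.toFun x * (q - r).toFun x - r.toFun x * (q - r).toFun x) := by
        simp_rw [← sub_mul, ← Scal.toFun_sub]
    _ = 0 := by
        rw [integral_sub (InL2.integrable_mul hq.1.2.1 hs.2.1)
          (InL2.integrable_mul hr.1.2.1 hs.2.1), h1, h2, sub_self]

/-! ### The discrete mass balance -/

section MassBalance

variable {n : ℕ}

/-- The left-hand side of the `i`-th mass-balance equation as a piecewise polynomial. -/
noncomputable def massBalancePoly (c : Params n) (u : Vect T) (v : Fin n → Vect T) (p : Fin n → Scal T)
    (i : Fin n) : Scal T :=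
  -u.div - (v i).div - (c.αp i + c.α i i) • p i + ∑ j ∈ Finset.univ.erase i, c.α i j • p j

theorem ev_massBalancePoly (c : Params n) (u : Vect T) (v : Fin n → Vect T) (p : Fin n → Scal T)
    (i : Fin n) (K : T.Element) (x : Pt d) :
    ev (massBalancePoly c u v p i K) x = massBalance c u v p i K x := by
  simp [ev, massBalancePoly, massBalance, Vect.div]

theorem IsDiscreteSolution.isL2Projection {fam : Family} {l : ℕ} (hl : 1 ≤ l) {η : ℝ}
    {c : Params n} {f : Pt d → Pt d} {g : Fin n → Pt d → ℝ} (hg : ∀ i, InL2 Ω (g i))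
    {u : Vect T} {v : Fin n → Vect T} {p : Fin n → Scal T}
    (h : IsDiscreteSolution fam l η c f g u v p) (i : Fin n) :
    IsL2Projection l (g i) (massBalancePoly c u v p i) := by
  have hu := div_mem_Ph_of_mem_Uh hl h.u_mem
  have hv := div_mem_Ph_of_mem_Vh (h.v_mem i)
  have hm : massBalancePoly c u v p i ∈ PhSubmodule T l :=
    add_mem (sub_mem (sub_mem (neg_mem hu) hv) (Submodule.smul_mem _ _ (h.p_mem i)))
      (sum_mem fun j _ => Submodule.smul_mem _ _ (h.p_mem j))
  refine (isL2Projection_iff (hg i) hm).2 fun r hr => ?_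
  rw [← h.mass i r hr]
  have hiu := InL2.integrable_mul hu.2.1 hr.2.1
  have hiv := InL2.integrable_mul hv.2.1 hr.2.1
  have hip (j : Fin n) := InL2.integrable_mul (h.p_mem j).2.1 hr.2.1
  have hx (x : Pt d) : (massBalancePoly c u v p i).toFun x * r.toFun x
      = -(u.div.toFun x * r.toFun x) - (v i).div.toFun x * r.toFun x
        + (-c.αp i - c.α i i) * ((p i).toFun x * r.toFun x)
        + ∑ j ∈ Finset.univ.erase i, c.α i j * ((p j).toFun x * r.toFun x) := by
    simp only [massBalancePoly, Scal.toFun_add, Scal.toFun_sub, Scal.toFun_neg, Scal.toFun_smul,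
      Scal.toFun_sum, add_mul, Finset.sum_mul, mul_assoc]
    ring
  simp_rw [hx]
  have hi1 := hiu.neg.sub hiv
  have hi2 := hi1.add ((hip i).const_mul (-c.αp i - c.α i i))
  have hi3 (j : Fin n) := (hip j).const_mul (c.α i j)
  refine (integral_add hi2 (integrable_finsetSum _ fun j _ => hi3 j)).trans ?_
  rw [integral_finsetSum _ fun j _ => hi3 j]
  simp_rw [integral_const_mul]
  congr 1
  refine (integral_add hi1 ((hip i).const_mul _)).trans ?_
  rw [integral_const_mul]
  congr 1
  refine (integral_sub hiu.neg hiv).trans ?_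
  congr 1
  exact integral_neg _

end MassBalance

end MPET

open MPET MeasureTheory in
theorem proposition4p1 (d n l : ℕ) (hd : d = 2 ∨ d = 3) (hl : 1 ≤ l)
    (Ω : Set (Pt d)) (hΩ : IsOpen Ω) (T : Triangulation d Ω)
    (fam : Family) (η : ℝ) (c : Params n)
    (f : Pt d → Pt d) (hf : InL2 Ω f) (g : Fin n → Pt d → ℝ) (hg : ∀ i, InL2 Ω (g i))
    (u : Vect T) (v : Fin n → Vect T) (p : Fin n → Scal T)
    (hsol : IsDiscreteSolution fam l η c f g u v p) (i : Fin n) :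
    (∃! q : Scal T, IsL2Projection l (g i) q) ∧
    (∀ q : Scal T, IsL2Projection l (g i) q →
      ∀ K : T.Element, ∀ x ∈ K.carrier, massBalance c u v p i K x = ev (q K) x) ∧
    (g i =ᵐ[volume.restrict Ω] 0 →
      ∀ K : T.Element, ∀ x ∈ K.carrier, massBalance c u v p i K x = 0) := by
  have hm := hsol.isL2Projection hl hg i
  refine ⟨⟨_, hm, fun q hq => hq.unique (hg i) hm⟩, fun q hq K x _ => ?_, fun h0 K x _ => ?_⟩
  · rw [hq.unique (hg i) hm, ev_massBalancePoly]
  · have hz : massBalancePoly c u v p i = 0 := by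
      -- Tested against itself, the projection of zero has zero `L²` norm.
      refine Ph.eq_zero_of_integral_sq hm.1 ?_
      rw [(isL2Projection_iff (hg i) hm.1).1 hm _ hm.1]
      refine integral_eq_zero_of_ae ?_
      filter_upwards [h0] with x hx
      simp [hx]
    rw [← ev_massBalancePoly, hz]
    simp [ev]
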